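/- A right-preordered group is a (not necessarily abelian) group $X$, written additively, with a reflexive and transitive relation $\leq$ such that $x\leq y$ implies $x+z\leq y+z$ for all $x,y,z\in X$. Let $\mathbf{ROrdGrp}$ be the category of right-preordered groups and monotone group homomorphisms. Then: 1. $\mathbf{ROrdGrp}$ is a regular category: it has finite limits, every kernel pair has a coequalizer, and regular epimorphisms are stable under pullback. 2. $\mathbf{ROrdGrp}$ is a normal category: it is regular, it has a zero object, and every regular epimorphism is a normal epimorphism (a cokernel of some morphism). 3. $\mathbf{ROrdGrp}$ is efficiently regular: it is regular, and whenever $T\rightrightarrows X$ is an (internal) equivalence relation, $R\rightrightarrows X$ is an effective equivalence relation (that is, the kernel pair of some morphism), and $j\colon T\to R$ is a regular monomorphism compatible with the projections to $X$, then $T$ is also effective. 4. $\mathbf{ROrdGrp}$ is not (Barr) exact: not every equivalence relation in $\mathbf{ROrdGrp}$ is effective. -/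

import Mathlib

open CategoryTheory Limits

universe u v

/-- A right-preordered group: a (not necessarily commutative, additively written) group with a
preorder such that `x ≤ y` implies `x + z ≤ y + z`. -/
structure ROrdGrp : Type (u + 1) where
  /-- The underlying type. -/
  carrier : Type u
  [addGroup : AddGroup carrier]
  [preorder : Preorder carrier]
  [addRightMono : AddRightMono carrier]

namespace ROrdGrp

attribute [instance] ROrdGrp.addGroup ROrdGrp.preorder ROrdGrp.addRightMono

instance : CoeSort ROrdGrp.{u} (Type u) := ⟨ROrdGrp.carrier⟩

/-- The bundled right-preordered group on a type. -/
abbrev of (X : Type u) [AddGroup X] [Preorder X] [AddRightMono X] : ROrdGrp.{u} := ⟨X⟩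

/-- A morphism of right-preordered groups is a monotone group homomorphism. -/
@[ext]
structure Hom (X Y : ROrdGrp.{u}) where
  /-- The underlying monotone homomorphism. -/
  hom' : X →+o Y

instance : Category ROrdGrp.{u} where
  Hom X Y := Hom X Y
  id X := ⟨OrderAddMonoidHom.id X⟩
  comp f g := ⟨g.hom'.comp f.hom'⟩

instance : ConcreteCategory ROrdGrp.{u} (fun X Y => X →+o Y) where
  hom := Hom.hom'
  ofHom := Hom.mk

/-- A monotone group homomorphism as a morphism of `ROrdGrp`. -/
abbrev ofHom {X Y : Type u} [AddGroup X] [Preorder X] [AddRightMono X]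
    [AddGroup Y] [Preorder Y] [AddRightMono Y] (f : X →+o Y) : of X ⟶ of Y :=
  ConcreteCategory.ofHom (C := ROrdGrp.{u}) f

/-- The zero morphisms are the constant homomorphisms. -/
instance : HasZeroMorphisms ROrdGrp.{u} where
  zero _ _ := ⟨⟨0⟩⟩
  comp_zero _ _ := rfl
  zero_comp _ _ _ f := Hom.ext (OrderAddMonoidHom.ext fun _ => map_zero f.hom')

end ROrdGrp

/-- A normal category: a pointed regular category in which every regular epimorphism is a normal
epimorphism, that is, a cokernel. -/
class IsNormalCategory (C : Type u) [Category.{v} C] [HasZeroMorphisms C] : Prop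
    extends Regular C, HasZeroObject C where
  nonempty_normalEpi {X Y : C} (f : X ⟶ Y) : IsRegularEpi f → Nonempty (NormalEpi f)

/-- An efficiently regular category: a regular category in which every equivalence relation
`T ⇉ X` that is a subobject of an effective equivalence relation `R ⇉ X` (a kernel pair), through
a regular monomorphism `j : T ⟶ R` over `X`, is itself effective. -/
class IsEfficientlyRegular (C : Type u) [Category.{v} C] : Prop extends Regular C where
  isEffective {X T R : C} (t₁ t₂ : T ⟶ X) (r₁ r₂ : R ⟶ X) (j : T ⟶ R) :
    IsEquivalenceRelation t₁ t₂ → IsEffectiveEquivalenceRelation r₁ r₂ →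
    j ≫ r₁ = t₁ → j ≫ r₂ = t₂ → IsRegularMono j → IsEffectiveEquivalenceRelation t₁ t₂

/-- A (Barr) exact category: a regular category in which every equivalence relation is effective,
that is, a kernel pair. -/
class IsBarrExact (C : Type u) [Category.{v} C] : Prop extends Regular C where
  isEffective {X R : C} (r₁ r₂ : R ⟶ X) :
    IsEquivalenceRelation r₁ r₂ → IsEffectiveEquivalenceRelation r₁ r₂

/-!
A right-preorder on a group is the same as its positive cone, which may be any submonoid. Hence a
homomorphism `φ : X →+ G` out of a right-preordered group coinduces a right-preorder on `G`, with
positive cone the image of that of `X`, just as a homomorphism into one induces a right-preorder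
on its domain. Regular epimorphisms are the surjections onto a group with the coinduced preorder;
such a morphism is the cokernel of its kernel.

If `T ⇉ X` is a reflexive relation, the class `N` of zero is a normal subgroup and `T` contains
every pair of elements congruent modulo `N`, so as a group `T` is the kernel pair of `X ⟶ X / N`.
As a right-preordered group it is a kernel pair exactly when its preorder is induced from `X × X`.
This condition passes to regular subobjects, whence efficient regularity, and it fails for the
relation `X × X` with the preorder coinduced along the diagonal, whence the failure of exactness.
-/

section Effective

variable {C : Type u} [Category.{v} C] {R X Y : C} {p q : R ⟶ X} {f : X ⟶ Y}

lemma isPushout_of_isKernelPair (h : IsKernelPair f p q) [IsRegularEpi f] :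
    IsPushout p q f f := by
  have exists_desc (s : PushoutCocone p q) : ∃ d, f ≫ d = s.inl ∧ f ≫ d = s.inr := by
    -- The diagonal, a common section of `p` and `q`, forces the legs of a cocone to be equal.
    have hs : s.inl = s.inr := by
      simpa only [h.lift_fst_assoc, h.lift_snd_assoc, Category.id_comp] using
        h.lift (𝟙 X) (𝟙 X) rfl ≫= s.condition
    obtain ⟨d, hd⟩ := IsRegularEpi.exists_of_isKernelPair f h s.inl (hs ▸ s.condition)
    exact ⟨d, hd, hd.trans hs⟩
  choose d hd₁ hd₂ using exists_desc
  exact ⟨⟨h.w⟩, ⟨PushoutCocone.IsColimit.mk h.w d hd₁ hd₂ fun s m hm _ =>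
    (cancel_epi f).1 (hm.trans (hd₁ s).symm)⟩⟩

lemma isEffectiveEquivalenceRelation_of_isKernelPair [HasPullbacks C] (h : IsKernelPair f p q)
    [IsRegularEpi f] : IsEffectiveEquivalenceRelation p q :=
  ⟨⟨{ IsKernelPair.equivalenceRelation f p q (pullbackIsPullback q p) h with
    B := Y
    π := f
    isKernelPair := h
    isPushout := isPushout_of_isKernelPair h }⟩⟩

end Effective

namespace ROrdGrp

variable {X Y Z : ROrdGrp.{u}}

section Order

/-- A group homomorphism preserving the positive cone, as a morphism of `ROrdGrp`. -/
def homMk (f : X →+ Y) (hf : ∀ x, 0 ≤ x → 0 ≤ f x) : X ⟶ Y where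
  hom' :=
    { toAddMonoidHom := f
      monotone' := fun x y h =>
        sub_nonneg.1 <| (hf (y - x) (sub_nonneg.2 h)).trans_eq (map_sub f y x) }

/-- The underlying group homomorphism of a morphism. -/
abbrev Hom.toAddMonoidHom (f : X ⟶ Y) : X →+ Y := (ConcreteCategory.hom f).toAddMonoidHom

instance {M N : Type*} [Add M] [Preorder M] [AddRightMono M] [Add N] [Preorder N]
    [AddRightMono N] : AddRightMono (M × N) :=
  ⟨fun c _ _ h => ⟨add_le_add_left h.1 c.1, add_le_add_left h.2 c.2⟩⟩

variable {G : Type u} [AddGroup G]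

section Induced

variable {M : Type*} [AddGroup M] [Preorder M] [AddRightMono M]

/-- The group `G` with the preorder induced along a homomorphism `φ : G →+ M`: the coarsest one
for which `φ` is monotone. -/
def induced (φ : G →+ M) : ROrdGrp.{u} where
  carrier := G
  preorder := Preorder.lift φ
  addRightMono := ⟨fun c a b h => by
    change φ (a + c) ≤ φ (b + c)
    simpa only [map_add] using add_le_add_left (show φ a ≤ φ b from h) (φ c)⟩

lemma nonneg_induced_iff {φ : G →+ M} {a : induced φ} : 0 ≤ a ↔ 0 ≤ φ a := by
  rw [← map_zero φ]
  rfl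

/-- The homomorphism along which a preorder is induced, as a morphism. -/
def inducedHom (φ : G →+ X) : induced φ ⟶ X :=
  homMk (X := induced φ) φ fun _ => nonneg_induced_iff.1

end Induced

section Coinduced

/-- The group `G` with the preorder coinduced along a homomorphism `φ : X →+ G`: the finest
compatible one for which `φ` is monotone. Its positive cone is the image of that of `X`. -/
def coinduced (φ : X →+ G) : ROrdGrp.{u} where
  carrier := G
  preorder :=
    { le := fun a b => ∃ x, 0 ≤ x ∧ φ x + a = b
      le_refl := fun a => ⟨0, le_rfl, by simp⟩
      le_trans := by
        rintro a _ _ ⟨x, hx, rfl⟩ ⟨y, hy, rfl⟩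
        exact ⟨y + x, hx.trans (le_add_of_nonneg_left hy), by simp [add_assoc]⟩ }
  addRightMono := ⟨by
    rintro c a _ ⟨x, hx, rfl⟩
    exact ⟨x, hx, (add_assoc _ _ _).symm⟩⟩

lemma nonneg_coinduced_iff {φ : X →+ G} {a : coinduced φ} : 0 ≤ a ↔ ∃ x, 0 ≤ x ∧ φ x = a :=
  exists_congr fun x => and_congr_right fun _ => Eq.congr_left (add_zero (φ x))

/-- The homomorphism along which a preorder is coinduced, as a morphism. -/
def coinducedHom (φ : X →+ G) : X ⟶ coinduced φ :=
  homMk (Y := coinduced φ) φ fun x hx => nonneg_coinduced_iff.2 ⟨x, hx, rfl⟩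

/-- A homomorphism is a morphism for the coinduced preorder if its composite with `φ` is one. -/
def coinducedDesc {φ : X →+ G} (g : G →+ Y) (h : ∀ x, 0 ≤ x → 0 ≤ g (φ x)) : coinduced φ ⟶ Y :=
  homMk (X := coinduced φ) g fun a ha => by
    obtain ⟨x, hx, rfl⟩ := nonneg_coinduced_iff.1 ha
    exact h x hx

end Coinduced

end Order

section FiniteLimits

lemma isZero_of_punit : IsZero (of PUnit.{u + 1}) where
  unique_to _ := ⟨⟨⟨0⟩, fun f => ConcreteCategory.hom_ext _ _ fun _ =>
    map_zero (ConcreteCategory.hom f)⟩⟩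
  unique_from _ := ⟨⟨⟨0⟩, fun _ => rfl⟩⟩

instance : HasZeroObject ROrdGrp.{u} := ⟨_, isZero_of_punit⟩

variable {B P : ROrdGrp.{u}} {f : X ⟶ B} {g : Y ⟶ B} {p : P ⟶ X} {q : P ⟶ Y}

lemma isPullback_of_existsUnique (w : p ≫ f = q ≫ g)
    (h : ∀ x y, f x = g y → ∃! z, p z = x ∧ q z = y)
    (hP : ∀ z, 0 ≤ p z → 0 ≤ q z → 0 ≤ z) : IsPullback p q f g := by
  have inj {a b : P} (hp : p a = p b) (hq : q a = q b) : a = b :=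
    (h _ _ (ConcreteCategory.congr_hom w b)).unique ⟨hp, hq⟩ ⟨rfl, rfl⟩
  have exists_lift (s : PullbackCone f g) : ∃ l : s.pt ⟶ P, l ≫ p = s.fst ∧ l ≫ q = s.snd := by
    choose l hl _ using fun z : s.pt => h _ _ (ConcreteCategory.congr_hom s.condition z)
    have map_add (a b : s.pt) : l (a + b) = l a + l b := inj
      (by simp only [(hl _).1, map_add]) (by simp only [(hl _).2, map_add])
    refine ⟨homMk (AddMonoidHom.mk' l map_add) fun z hz => hP _ ?_ ?_,
      ConcreteCategory.hom_ext _ _ fun z => (hl z).1,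
      ConcreteCategory.hom_ext _ _ fun z => (hl z).2⟩
    · exact (hl z).1 ▸ map_nonneg (ConcreteCategory.hom s.fst) hz
    · exact (hl z).2 ▸ map_nonneg (ConcreteCategory.hom s.snd) hz
  choose l hl₁ hl₂ using exists_lift
  refine ⟨⟨w⟩, ⟨PullbackCone.IsLimit.mk w l hl₁ hl₂ fun s m h₁ h₂ => ?_⟩⟩
  exact ConcreteCategory.hom_ext _ _ fun z => inj
    (ConcreteCategory.congr_hom (h₁.trans (hl₁ s).symm) z)
    (ConcreteCategory.congr_hom (h₂.trans (hl₂ s).symm) z)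

variable (f g)

/-- The fibre product of two morphisms: the pairs of elements with the same image, ordered
componentwise. -/
def fibreProduct : ROrdGrp.{u} :=
  induced ((f.toAddMonoidHom.comp (.fst X Y)).eqLocus
    (g.toAddMonoidHom.comp (.snd X Y))).subtype

/-- The first projection of a fibre product. -/
def fibreFst : fibreProduct f g ⟶ X :=
  homMk (X := fibreProduct f g) ((AddMonoidHom.fst X Y).comp (AddSubgroup.subtype _))
    fun _ h => h.1

/-- The second projection of a fibre product. -/
def fibreSnd : fibreProduct f g ⟶ Y :=
  homMk (X := fibreProduct f g) ((AddMonoidHom.snd X Y).comp (AddSubgroup.subtype _))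
    fun _ h => h.2

lemma isPullback_fibreProduct : IsPullback (fibreFst f g) (fibreSnd f g) f g :=
  isPullback_of_existsUnique (ConcreteCategory.hom_ext _ _ fun z => z.2)
    (fun x y h => ⟨⟨(x, y), h⟩, ⟨rfl, rfl⟩, fun _ hz => Subtype.ext (Prod.ext hz.1 hz.2)⟩)
    fun _ h₁ h₂ => ⟨h₁, h₂⟩

instance : HasPullbacks ROrdGrp.{u} :=
  have {X Y B : ROrdGrp.{u}} {f : X ⟶ B} {g : Y ⟶ B} : HasLimit (cospan f g) :=
    (isPullback_fibreProduct f g).hasPullback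
  hasPullbacks_of_hasLimit_cospan _

instance : HasFiniteLimits ROrdGrp.{u} :=
  have := HasZeroObject.hasTerminal (C := ROrdGrp.{u})
  hasFiniteLimits_of_hasTerminal_and_pullbacks

variable {f g}

lemma isPullback_iff (w : p ≫ f = q ≫ g) :
    IsPullback p q f g ↔ (∀ x y, f x = g y → ∃! z, p z = x ∧ q z = y) ∧
      ∀ z, 0 ≤ p z → 0 ≤ q z → 0 ≤ z := by
  refine ⟨fun h => ?_, fun h => isPullback_of_existsUnique w h.1 h.2⟩
  let e := h.isoIsPullback X Y (isPullback_fibreProduct f g)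
  have inv_mk (z : P) : e.inv ⟨(p z, q z), ConcreteCategory.congr_hom w z⟩ = z := by
    have hom_apply : e.hom z = ⟨(p z, q z), ConcreteCategory.congr_hom w z⟩ :=
      Subtype.ext <| Prod.ext
        (ConcreteCategory.congr_hom (h.isoIsPullback_hom_fst X Y (isPullback_fibreProduct f g)) z)
        (ConcreteCategory.congr_hom (h.isoIsPullback_hom_snd X Y (isPullback_fibreProduct f g)) z)
    rw [← hom_apply]
    exact ConcreteCategory.congr_hom e.hom_inv_id z
  constructor
  · intro x y hxy
    refine ⟨e.inv ⟨(x, y), hxy⟩, ⟨?_, ?_⟩, ?_⟩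
    · exact ConcreteCategory.congr_hom (h.isoIsPullback_inv_fst X Y _) _
    · exact ConcreteCategory.congr_hom (h.isoIsPullback_inv_snd X Y _) _
    · rintro z ⟨rfl, rfl⟩
      exact (inv_mk z).symm
  · intro z h₁ h₂
    rw [← inv_mk z]
    exact map_nonneg (ConcreteCategory.hom e.inv) (show 0 ≤ _ from ⟨h₁, h₂⟩)

end FiniteLimits

section Mono

variable {R : ROrdGrp.{u}} {p : R ⟶ X} {q : R ⟶ Y}

lemma eq_of_jointlyMono (h : JointlyMono₂ p q) {a b : R} (h₁ : p a = p b) (h₂ : q a = q b) :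
    a = b := by
  let K : AddSubgroup R := p.toAddMonoidHom.ker ⊓ q.toAddMonoidHom.ker
  have hK : inducedHom K.subtype = 0 := h.right_cancellation _ _
    (ConcreteCategory.hom_ext _ _ fun k => k.2.1.trans (map_zero (ConcreteCategory.hom p)).symm)
    (ConcreteCategory.hom_ext _ _ fun k => k.2.2.trans (map_zero (ConcreteCategory.hom q)).symm)
  have hab : a - b ∈ K := ⟨by simp [h₁], by simp [h₂]⟩
  exact sub_eq_zero.1 (ConcreteCategory.congr_hom hK ⟨a - b, hab⟩)

lemma nonneg_of_isRegularMono {j : X ⟶ Y} (hj : IsRegularMono j) {x : X} (hx : 0 ≤ j x) :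
    0 ≤ x := by
  obtain ⟨⟨h⟩⟩ := hj
  have := h.mono
  let i : X ⟶ induced j.toAddMonoidHom :=
    homMk (Y := induced j.toAddMonoidHom) (.id X) fun _ hx =>
      nonneg_induced_iff.2 (map_nonneg (ConcreteCategory.hom j) hx)
  obtain ⟨l, hl⟩ : ∃ l, l ≫ j = inducedHom j.toAddMonoidHom :=
    ⟨_, Fork.IsLimit.lift_ι' h.isLimit (inducedHom j.toAddMonoidHom)
      (ConcreteCategory.hom_ext _ _ fun x : X => ConcreteCategory.congr_hom h.w x)⟩
  have hil : i ≫ l = 𝟙 X := by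
    rw [← cancel_mono j, Category.assoc, hl]
    rfl
  have : 0 ≤ l (i x) := map_nonneg (ConcreteCategory.hom l) (nonneg_induced_iff.2 hx)
  rwa [← ConcreteCategory.comp_apply, hil] at this

end Mono

/-- A morphism is a quotient map if it is surjective and its codomain carries the coinduced
preorder; these turn out to be the regular epimorphisms. -/
structure IsQuotientMap (f : X ⟶ Y) : Prop where
  surjective : Function.Surjective f
  exists_nonneg : ∀ y, 0 ≤ y → ∃ x, 0 ≤ x ∧ f x = y

lemma isQuotientMap_coinducedHom {G : Type u} [AddGroup G] {φ : X →+ G}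
    (hφ : Function.Surjective φ) : IsQuotientMap (coinducedHom φ) where
  surjective := hφ
  exists_nonneg _ := nonneg_coinduced_iff.1

namespace IsQuotientMap

variable {f : X ⟶ Y}

lemma exists_desc (hf : IsQuotientMap f) (g : X ⟶ Z)
    (hg : f.toAddMonoidHom.ker ≤ g.toAddMonoidHom.ker) : ∃ d : Y ⟶ Z, f ≫ d = g := by
  let d : Y →+ Z := f.toAddMonoidHom.liftOfSurjective hf.surjective ⟨g.toAddMonoidHom, hg⟩
  have hd (x : X) : d (f x) = g x :=
    AddMonoidHom.liftOfRightInverse_comp_apply f.toAddMonoidHom _ _ _ x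
  refine ⟨homMk d fun y hy => ?_, ConcreteCategory.hom_ext _ _ hd⟩
  obtain ⟨x, hx, rfl⟩ := hf.exists_nonneg y hy
  exact hd x ▸ map_nonneg (ConcreteCategory.hom g) hx

lemma nonempty_normalEpi (hf : IsQuotientMap f) : Nonempty (NormalEpi f) := by
  have := ConcreteCategory.epi_of_surjective f hf.surjective
  refine ⟨⟨_, inducedHom f.toAddMonoidHom.ker.subtype, ConcreteCategory.hom_ext _ _ fun k => k.2,
    CokernelCofork.IsColimit.ofπ' f _ fun g hg => Classical.indefiniteDescription _ ?_⟩⟩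
  exact hf.exists_desc g fun x hx =>
    show g x = 0 from ConcreteCategory.congr_hom hg ⟨x, hx⟩

lemma isRegularEpi (hf : IsQuotientMap f) : IsRegularEpi f :=
  have ⟨_⟩ := hf.nonempty_normalEpi
  isRegularEpi_of_regularEpi (NormalEpi.regularEpi f)

lemma of_isPullback {P B : ROrdGrp.{u}} {p : P ⟶ X} {q : P ⟶ Y} {f : X ⟶ B} {g : Y ⟶ B}
    (h : IsPullback p q f g) (hf : IsQuotientMap f) : IsQuotientMap q := by
  obtain ⟨existsUnique, nonneg⟩ := (isPullback_iff h.w).1 h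
  constructor
  · intro y
    obtain ⟨x, hx⟩ := hf.surjective (g y)
    obtain ⟨z, hz, -⟩ := existsUnique x y hx
    exact ⟨z, hz.2⟩
  · intro y hy
    obtain ⟨x, hx, hxy⟩ := hf.exists_nonneg (g y) (map_nonneg (ConcreteCategory.hom g) hy)
    obtain ⟨z, ⟨rfl, rfl⟩, -⟩ := existsUnique x y hxy
    exact ⟨z, nonneg z hx hy, rfl⟩

end IsQuotientMap

lemma exists_isQuotientMap_comp_mono (f : X ⟶ Y) :
    ∃ (I : ROrdGrp.{u}) (e : X ⟶ I) (m : I ⟶ Y), IsQuotientMap e ∧ Mono m ∧ e ≫ m = f :=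
  ⟨coinduced f.toAddMonoidHom.rangeRestrict, coinducedHom _,
    coinducedDesc f.toAddMonoidHom.range.subtype fun _ => map_nonneg (ConcreteCategory.hom f),
    isQuotientMap_coinducedHom f.toAddMonoidHom.rangeRestrict_surjective,
    ConcreteCategory.mono_of_injective _ Subtype.val_injective, rfl⟩

lemma isQuotientMap_of_isRegularEpi {f : X ⟶ Y} (hf : IsRegularEpi f) : IsQuotientMap f := by
  obtain ⟨I, e, m, he, hm, rfl⟩ := exists_isQuotientMap_comp_mono f
  have := ExtremalEpi.isIso (e ≫ m) e m rfl
  have map_inv (y : Y) : m (inv m y) = y := ConcreteCategory.congr_hom (IsIso.inv_hom_id m) y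
  constructor
  · intro y
    obtain ⟨x, hx⟩ := he.surjective (inv m y)
    exact ⟨x, (congrArg m hx).trans (map_inv y)⟩
  · intro y hy
    obtain ⟨x, hx, hxy⟩ :=
      he.exists_nonneg (inv m y) (map_nonneg (ConcreteCategory.hom (inv m)) hy)
    exact ⟨x, hx, (congrArg m hxy).trans (map_inv y)⟩

lemma isRegularEpi_iff {f : X ⟶ Y} : IsRegularEpi f ↔ IsQuotientMap f :=
  ⟨isQuotientMap_of_isRegularEpi, fun h => h.isRegularEpi⟩

instance : Regular ROrdGrp.{u} where
  hasCoequalizer_of_isKernelPair {_ _ _ f p q} h := by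
    obtain ⟨I, e, m, he, _, rfl⟩ := exists_isQuotientMap_comp_mono f
    have := he.isRegularEpi
    exact ⟨⟨_, (h.cancel_right_of_mono).toCoequalizer'⟩⟩
  regularEpiIsStableUnderBaseChange := ⟨fun h hf =>
    isRegularEpi_iff.2 (.of_isPullback h (isRegularEpi_iff.1 hf))⟩

instance : IsNormalCategory ROrdGrp.{u} where
  nonempty_normalEpi _ hf := (isRegularEpi_iff.1 hf).nonempty_normalEpi

section ReflexiveRelation

variable {R : ROrdGrp.{u}} {p q : R ⟶ X}

/-- The class of zero for a relation `p, q : R ⟶ X`: the elements related to zero. -/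
def zeroClass (p q : R ⟶ X) : AddSubgroup X := q.toAddMonoidHom.ker.map p.toAddMonoidHom

variable (h : ReflexiveRelation p q)
include h

lemma zeroClass_normal : (zeroClass p q).Normal :=
  AddMonoidHom.normal_ker _ |>.map _ fun x =>
    ⟨h.r x, ConcreteCategory.congr_hom h.reflexivity₁ x⟩

lemma exists_eq_iff_neg_add_mem_zeroClass {x y : X} :
    (∃ t, p t = x ∧ q t = y) ↔ -x + y ∈ zeroClass p q := by
  have hp (x : X) : p (h.r x) = x := ConcreteCategory.congr_hom h.reflexivity₁ x
  have hq (x : X) : q (h.r x) = x := ConcreteCategory.congr_hom h.reflexivity₂ x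
  constructor
  · rintro ⟨t, rfl, rfl⟩
    exact ⟨-t + h.r (q t), by simp [hq], by simp [hp]⟩
  · rintro ⟨t, ht, hxy⟩
    replace ht : q t = 0 := ht
    replace hxy : p t = -x + y := hxy
    exact ⟨h.r y + -t, by simp [hp, hxy], by simp [hq, ht]⟩

lemma isEffectiveEquivalenceRelation_iff :
    IsEffectiveEquivalenceRelation p q ↔ ∀ t, 0 ≤ p t → 0 ≤ q t → 0 ≤ t := by
  refine ⟨fun ⟨⟨e⟩⟩ => ((isPullback_iff e.isPushout.w).1 e.isKernelPair).2, fun hR => ?_⟩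
  have := zeroClass_normal h
  let π := coinducedHom (QuotientAddGroup.mk' (zeroClass p q))
  have hπ (x y : X) : π x = π y ↔ ∃ t, p t = x ∧ q t = y :=
    QuotientAddGroup.eq.trans (exists_eq_iff_neg_add_mem_zeroClass h).symm
  have : IsRegularEpi π :=
    (isQuotientMap_coinducedHom (QuotientAddGroup.mk'_surjective _)).isRegularEpi
  have kernelPair : IsKernelPair π p q := by
    refine isPullback_of_existsUnique
      (ConcreteCategory.hom_ext _ _ fun t => (hπ _ _).2 ⟨t, rfl, rfl⟩) (fun x y hxy => ?_) hR
    obtain ⟨t, ht⟩ := (hπ x y).1 hxy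
    exact ⟨t, ht, fun s hs => eq_of_jointlyMono h.toJointlyMono₂
      (hs.1.trans ht.1.symm) (hs.2.trans ht.2.symm)⟩
  exact isEffectiveEquivalenceRelation_of_isKernelPair kernelPair

end ReflexiveRelation

instance : IsEfficientlyRegular ROrdGrp.{u} where
  isEffective t₁ t₂ r₁ r₂ j := by
    rintro ⟨⟨hT⟩⟩ ⟨⟨hR⟩⟩ rfl rfl hj
    have hR' := (isEffectiveEquivalenceRelation_iff hR.toReflexiveRelation).1 ⟨⟨hR⟩⟩
    exact (isEffectiveEquivalenceRelation_iff hT.toReflexiveRelation).2 fun t h₁ h₂ =>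
      nonneg_of_isRegularMono hj (hR' (j t) h₁ h₂)

section FullRelation

/-- The relation on `X` under which any two elements are related, with the preorder coinduced
along the diagonal: the finest one for which the relation is reflexive in `ROrdGrp`. -/
def fullRelation (X : ROrdGrp.{u}) : ROrdGrp.{u} :=
  coinduced ((AddMonoidHom.id X).prod (.id X))

lemma nonneg_fullRelation_iff {a : fullRelation X} : 0 ≤ a ↔ 0 ≤ a.1 ∧ a.1 = a.2 := by
  refine nonneg_coinduced_iff.trans ⟨?_, fun h => ⟨a.1, h.1, Prod.ext rfl h.2⟩⟩
  rintro ⟨x, hx, rfl⟩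
  exact ⟨hx, rfl⟩

/-- The first projection of the full relation. -/
def fullFst (X : ROrdGrp.{u}) : fullRelation X ⟶ X :=
  coinducedDesc (.fst X X) fun _ => id

/-- The second projection of the full relation. -/
def fullSnd (X : ROrdGrp.{u}) : fullRelation X ⟶ X :=
  coinducedDesc (.snd X X) fun _ => id

/-- Transitivity of the full relation: the outer components of a composable pair. -/
def fullTrans (X : ROrdGrp.{u}) : fibreProduct (fullSnd X) (fullFst X) ⟶ fullRelation X :=
  homMk (Y := fullRelation X)
    ((fibreFst _ _ ≫ fullFst X).toAddMonoidHom.prod (fibreSnd _ _ ≫ fullSnd X).toAddMonoidHom)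
    fun z hz =>
      have h₁ := nonneg_fullRelation_iff.1 hz.1
      have h₂ := nonneg_fullRelation_iff.1 hz.2
      nonneg_fullRelation_iff.2 ⟨h₁.1, h₁.2.trans (z.2.trans h₂.2)⟩

lemma isEquivalenceRelation_fullRelation (X : ROrdGrp.{u}) :
    IsEquivalenceRelation (fullFst X) (fullSnd X) :=
  EquivalenceRelation.isEquivalenceRelation
    { right_cancellation := fun _ _ _ h₁ h₂ => ConcreteCategory.hom_ext _ _ fun z => Prod.ext
        (ConcreteCategory.congr_hom h₁ z) (ConcreteCategory.congr_hom h₂ z)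
      r := coinducedHom _
      reflexivity₁ := rfl
      reflexivity₂ := rfl
      s := coinducedDesc (Y := fullRelation X) ((AddMonoidHom.snd X X).prod (.fst X X))
        fun x hx => nonneg_coinduced_iff.2 ⟨x, hx, rfl⟩
      symmetry₁ := rfl
      symmetry₂ := rfl
      c := (isPullback_fibreProduct (fullSnd X) (fullFst X)).cone
      isLimit := (isPullback_fibreProduct (fullSnd X) (fullFst X)).isLimit
      t := fullTrans X
      transitivity₁ := rfl
      transitivity₂ := rfl }

lemma eq_zero_of_isEffectiveEquivalenceRelation_fullRelation
    (h : IsEffectiveEquivalenceRelation (fullFst X) (fullSnd X)) {x : X} (hx : 0 ≤ x) : x = 0 := by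
  obtain ⟨⟨e⟩⟩ := isEquivalenceRelation_fullRelation X
  have := (isEffectiveEquivalenceRelation_iff e.toReflexiveRelation).1 h (x, 0) hx le_rfl
  exact (nonneg_fullRelation_iff.1 this).2

end FullRelation

lemma not_isBarrExact : ¬ IsBarrExact ROrdGrp.{u} := fun h => by
  let integers : ROrdGrp.{u} := induced (AddEquiv.ulift : ULift.{u} ℤ ≃+ ℤ).toAddMonoidHom
  have nonneg_one : (0 : integers) ≤ ULift.up 1 := nonneg_induced_iff.2 zero_le_one
  have one_eq_zero := eq_zero_of_isEffectiveEquivalenceRelation_fullRelation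
    (h.isEffective _ _ (isEquivalenceRelation_fullRelation integers)) nonneg_one
  exact one_ne_zero (congrArg ULift.down one_eq_zero)

end ROrdGrp

theorem proposition2p6 :
    Regular ROrdGrp.{u} ∧ IsNormalCategory ROrdGrp.{u} ∧
      IsEfficientlyRegular ROrdGrp.{u} ∧ ¬ IsBarrExact ROrdGrp.{u} :=
  ⟨inferInstance, inferInstance, inferInstance, ROrdGrp.not_isBarrExact⟩
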